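/- **Setting.** Write $M_n=M_n(\mathbb C)$ and $\mathfrak{sl}_n\subset M_n$ for the traceless matrices. For a complex unital algebra $\mathcal A$, $\Omega^p_{\rm Der}(\mathcal A)$ is the space of alternating maps $\mathrm{Der}(\mathcal A)^p\to\mathcal A$ that are multilinear over the center of $\mathcal A$, $\Omega^*_{\rm Der}(\mathcal A)=\bigoplus_{p\ge 0}\Omega^p_{\rm Der}(\mathcal A)$, and $$(\omega\wedge\eta)(X_1,\dots,X_{p+q})=\tfrac1{p!q!}\sum_{\sigma\in S_{p+q}}\mathrm{sgn}(\sigma)\,\omega(X_{\sigma(1)},\dots,X_{\sigma(p)})\,\eta(X_{\sigma(p+1)},\dots,X_{\sigma(p+q)}).$$ One has $\mathrm{Der}(M_n)=\{\mathrm{ad}_a: a\in\mathfrak{sl}_n\}$, with metric $g(\mathrm{ad}_a,\mathrm{ad}_b)=\mathrm{tr}(ab)$ for $a,b\in\mathfrak{sl}_n$. Given a basis $(E_\alpha)_{\alpha\in I}$ of $\mathfrak{sl}_n$ with totally ordered index set $\alpha^0_1<\dots<\alpha^0_d$, put $\partial_\alpha=\mathrm{ad}_{E_\alpha}$, let $(\theta^\alpha)$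 be the dual basis, $g_{\alpha\beta}=g(\partial_\alpha,\partial_\beta)$, $(g^{\alpha\beta})$ the inverse matrix, $|g|=\det(g_{\alpha\beta})$, and fix a square root $\sqrt{|g|}$. The integral $\int_{M_n}$ vanishes on forms of degree $<d$, and $\int_{M_n}a\sqrt{|g|}\,\theta^{\alpha^0_1}\wedge\cdots\wedge\theta^{\alpha^0_d}=\mathrm{tr}(a)$. On $p$-forms, with $\omega_{\alpha_1\dots\alpha_p}=\omega(\partial_{\alpha_1},\dots,\partial_{\alpha_p})$ and summation over repeated indices, $$\star\omega=\tfrac1{(d-p)!\,p!}\sqrt{|g|}\;\omega_{\ell'_1\dots\ell'_p}\,g^{\ell_1\ell'_1}\cdots g^{\ell_p\ell'_p}\,\epsilon_{\ell_1\dots\ell_d}\;\theta^{\ell_{p+1}}\wedge\cdots\wedge\theta^{\ell_d},$$ $\epsilon$ being totally antisymmetric with $\epsilon_{\alpha^0_1\dots\alpha^0_d}=1$. For $\mathcal A=\bigoplus_{i=1}^rM_{n_i}$, forms decompose as $\omega=\bigoplus_i\omega_i$ with $\omega_i\in\Omega^*_{\rm Der}(M_{n_i})$; put $\int_{\mathcal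 A}\omega=\sum_i\int_i\omega_i$ and $\star_{\mathcal A}\omega=\bigoplus_i\star_i\omega_i$, where $\int_i$ and $\star_i$ are those of $M_{n_i}$ for a basis $(E^i_\alpha)_{\alpha\in I_i}$ of $\mathfrak{sl}_{n_i}$; write $\partial^i_\alpha=\mathrm{ad}_{E^i_\alpha}$. Let $\mathcal B=M_m$ with $m\ge\sum_i\alpha_in_i$, and let $\phi:\mathcal A\to\mathcal B$ send $a_1\oplus\dots\oplus a_r$ to the block-diagonal matrix with $\alpha_1$ copies of $a_1$, then $\alpha_2$ copies of $a_2$, …, then $\alpha_r$ copies of $a_r$, then zeros. Let $\phi_i^\ell:M_{n_i}\to M_m$ be the insertion into the $\ell$-th of the $\alpha_i$ blocks belonging to $i$. Call the derivations $\phi_i^\ell(\partial^i_\alpha):=\mathrm{ad}_{\phi_i^\ell(E^i_\alpha)}$ of $\mathcal B$ *inherited*, and say that such a derivation comes from the block $(i,\ell)$. Complete the family $\phi_i^\ell(E^i_\alpha)$, indexed by $J^\phi=\{(i,\ell,\alpha)\}$, to a basis $(E_{\mathcal B,\beta})_{\beta\in J}$ of $\mathfrak{sl}_m$, $J=J^\phi\sqcup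 J^c$, such that the *complementary* derivations $\partial_{\mathcal B,\beta}=\mathrm{ad}_{E_{\mathcal B,\beta}}$, $\beta\in J^c$, are orthogonal to all inherited ones; choose any total order on $J$. Let $\omega=\bigoplus_i\omega_i\in\Omega^*_{\rm Der}(\mathcal A)$ and $\eta\in\Omega^*_{\rm Der}(\mathcal B)$, not necessarily homogeneous, be $\phi$-compatible: for all $p\ge1$, $i$, $1\le\ell\le\alpha_i$, $\alpha_1,\dots,\alpha_p\in I_i$, $$\phi_i^\ell\big(\omega_i(\partial^i_{\alpha_1},\dots,\partial^i_{\alpha_p})\big)=\eta\big(\phi_i^\ell(\partial^i_{\alpha_1}),\dots,\phi_i^\ell(\partial^i_{\alpha_p})\big),$$ and $\eta=\phi(\omega)$ in degree $0$. Suppose that these are the only possible non-zero values of $\eta$, that is: * $\eta$ vanishes as soon as one of its arguments is a complementary derivation; * $\eta$ vanishes on every tuple of inherited derivations that do not all come from the same block $(i,\ell)$ (no condition in degrees $\le 1$). **Proposition.** If every $\alpha_i=1$, then $$\int_{\mathcal B}\eta\wedge\star_{\mathcal B}\eta=\int_{\mathcal A}\omega\wedge\star_{\mathcal A}\omega .$$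 **Corollary.** For arbitrary multiplicities $\alpha_i$, $$\int_{\mathcal B}\eta\wedge\star_{\mathcal B}\eta=\sum_{i=1}^r\alpha_i\int_i\omega_i\wedge\star_i\omega_i .$$ -/

import Mathlib

open scoped DirectSum BigOperators

noncomputable section

namespace NCForms

/-! ### Derivations and derivation-based forms of a complex unital associative algebra -/

section General

variable (A : Type*) [Ring A] [Algebra ℂ A]

/-- `Der(A)`: the complex-linear maps `X : A → A` with `X (a b) = (X a) b + a (X b)`, as a module
over the center of `A` for `(f X) a = f (X a)`. -/
def Der : Submodule (Subalgebra.center ℂ A) (A →ₗ[ℂ] A) where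
  carrier := {X | ∀ a b, X (a * b) = X a * b + a * X b}
  add_mem' := by
    intro X Y hX hY a b
    have h1 := hX a b
    have h2 := hY a b
    simp only [LinearMap.add_apply, h1, h2]
    noncomm_ring
  zero_mem' := by intro a b; simp
  smul_mem' := by
    intro f X hX a b
    have hf := Subalgebra.mem_center_iff.1 f.2
    have h1 := hX a b
    simp only [LinearMap.smul_apply, Subalgebra.smul_def, smul_eq_mul, h1, mul_add]
    rw [← mul_assoc, ← mul_assoc, ← mul_assoc, hf a]

instance instModuleCenterDer : Module (Subalgebra.center ℂ A) (Der A) := (Der A).module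

instance instSMulCenterDer : SMul (Subalgebra.center ℂ A) (Der A) :=
  (instModuleCenterDer A).toSMul

variable {A}

/-- The inner derivation `ad_a : b ↦ [a, b]`. -/
def innerDer (a : A) : Der A :=
  ⟨LinearMap.mulLeft ℂ a - LinearMap.mulRight ℂ a, by
    intro b c
    simp only [LinearMap.sub_apply, LinearMap.mulLeft_apply, LinearMap.mulRight_apply]
    noncomm_ring⟩

variable (A)

/-- `Ω^p_Der(A)`: alternating maps `Der(A)^p → A`, multilinear over the center of `A`. -/
abbrev Form (p : ℕ) : Type _ := (Der A) [⋀^Fin p]→ₗ[Subalgebra.center ℂ A] A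

/-- `Ω^*_Der(A) = ⨁_p Ω^p_Der(A)`. -/
abbrev Forms : Type _ := ⨁ p : ℕ, Form A p

variable {A}

/-- The multilinear map `(X_1, …, X_{p+q}) ↦ ω(X_1, …, X_p) η(X_{p+1}, …, X_{p+q})`. -/
def mulForms {p q : ℕ} (ω : Form A p) (η : Form A q) :
    MultilinearMap (Subalgebra.center ℂ A) (fun _ : Fin (p + q) => Der A) A :=
  MultilinearMap.mk' (fun X => ω (fun k => X (Fin.castAdd q k)) * η (fun k => X (Fin.natAdd p k)))
    (by
      intro X k x y
      refine Fin.addCases (fun k => ?_) (fun k => ?_) k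
      · have h (z : Der A) : (fun l => Function.update X (Fin.castAdd q k) z (Fin.castAdd q l))
            = Function.update (fun l => X (Fin.castAdd q l)) k z :=
          Function.update_comp_eq_of_injective X (Fin.castAdd_injective p q) k z
        have h' (z : Der A) : (fun l => Function.update X (Fin.castAdd q k) z (Fin.natAdd p l))
            = fun l => X (Fin.natAdd p l) := by
          funext l
          exact Function.update_of_ne (by simp [Fin.ext_iff]; omega) _ _
        simp only [h, h', ω.map_update_add, add_mul]
      · have h (z : Der A) : (fun l => Function.update X (Fin.natAdd p k) z (Fin.natAdd p l))
            = Function.update (fun l => X (Fin.natAdd p l)) k z :=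
          Function.update_comp_eq_of_injective X (Fin.natAdd_injective q p) k z
        have h' (z : Der A) : (fun l => Function.update X (Fin.natAdd p k) z (Fin.castAdd q l))
            = fun l => X (Fin.castAdd q l) := by
          funext l
          exact Function.update_of_ne (by simp [Fin.ext_iff]; omega) _ _
        simp only [h, h', η.map_update_add, mul_add])
    (by
      intro X k f x
      have hf := Subalgebra.mem_center_iff.1 f.2
      refine Fin.addCases (fun k => ?_) (fun k => ?_) k
      · have h (z : Der A) : (fun l => Function.update X (Fin.castAdd q k) z (Fin.castAdd q l))
            = Function.update (fun l => X (Fin.castAdd q l)) k z :=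
          Function.update_comp_eq_of_injective X (Fin.castAdd_injective p q) k z
        have h' (z : Der A) : (fun l => Function.update X (Fin.castAdd q k) z (Fin.natAdd p l))
            = fun l => X (Fin.natAdd p l) := by
          funext l
          exact Function.update_of_ne (by simp [Fin.ext_iff]; omega) _ _
        simp only [h, h', ω.map_update_smul, Subalgebra.smul_def, smul_eq_mul, mul_assoc]
      · have h (z : Der A) : (fun l => Function.update X (Fin.natAdd p k) z (Fin.natAdd p l))
            = Function.update (fun l => X (Fin.natAdd p l)) k z :=
          Function.update_comp_eq_of_injective X (Fin.natAdd_injective q p) k z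
        have h' (z : Der A) : (fun l => Function.update X (Fin.natAdd p k) z (Fin.castAdd q l))
            = fun l => X (Fin.castAdd q l) := by
          funext l
          exact Function.update_of_ne (by simp [Fin.ext_iff]; omega) _ _
        simp only [h, h', η.map_update_smul, Subalgebra.smul_def, smul_eq_mul]
        rw [← mul_assoc, hf, mul_assoc])

/-- The product of forms
`(ω ∧ η)(X_1, …, X_{p+q}) = 1/(p! q!) ∑_σ sgn(σ) ω(X_{σ(1)}, …, X_{σ(p)}) η(X_{σ(p+1)}, …)`. -/
def wedge {p q : ℕ} (ω : Form A p) (η : Form A q) : Form A (p + q) :=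
  ((1 : ℂ) / ((p.factorial : ℂ) * (q.factorial : ℂ))) •
    MultilinearMap.alternatization (mulForms ω η)

theorem wedge_apply {p q : ℕ} (ω : Form A p) (η : Form A q) (X : Fin (p + q) → Der A) :
    wedge ω η X = ((1 : ℂ) / ((p.factorial : ℂ) * (q.factorial : ℂ))) •
      ∑ σ : Equiv.Perm (Fin (p + q)), Equiv.Perm.sign σ •
        (ω (fun k => X (σ (Fin.castAdd q k))) * η (fun k => X (σ (Fin.natAdd p k)))) := by
  simp [wedge, MultilinearMap.alternatization_apply, mulForms]

/-- The wedge product as a biadditive map on homogeneous forms. -/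
def wedgeHom (p q : ℕ) : Form A p →+ Form A q →+ Form A (p + q) :=
  AddMonoidHom.mk' (fun ω => AddMonoidHom.mk' (fun η => wedge ω η)
    (by
      intro η η'
      ext X
      simp only [wedge_apply, AlternatingMap.add_apply, mul_add, smul_add,
        Finset.sum_add_distrib]))
    (by
      intro ω ω'
      ext η X
      simp only [AddMonoidHom.mk'_apply, AddMonoidHom.add_apply, wedge_apply,
        AlternatingMap.add_apply, add_mul, smul_add, Finset.sum_add_distrib])

/-- The wedge product on `Ω^*_Der(A)`, extended biadditively from homogeneous forms. -/
def wedgeForms : Forms A →+ Forms A →+ Forms A :=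
  DirectSum.toAddMonoid fun p => AddMonoidHom.flip <|
    DirectSum.toAddMonoid fun q => AddMonoidHom.flip <|
      (DirectSum.of (Form A) (p + q)).compHom.comp (wedgeHom p q)

theorem wedgeForms_of {p q : ℕ} (ω : Form A p) (η : Form A q) :
    wedgeForms (DirectSum.of (Form A) p ω) (DirectSum.of (Form A) q η)
      = DirectSum.of (Form A) (p + q) (wedge ω η) := by
  simp [wedgeForms, wedgeHom]

end General

/-! ### Direct sums of algebras: `A = A_1 ⊕ ⋯ ⊕ A_r` -/

section Sums

variable {r : ℕ} {A : Fin r → Type*} [∀ i, Ring (A i)] [∀ i, Algebra ℂ (A i)]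

/-- The component `X_i = π^i ∘ X ∘ ι_i ∈ Der(A_i)` of a derivation `X` of `⨁_i A_i`. -/
def derProj (i : Fin r) (X : Der (∀ i, A i)) : Der (A i) :=
  ⟨LinearMap.proj i ∘ₗ X.1 ∘ₗ LinearMap.single ℂ A i, by
    intro a b
    have h := X.2 (Pi.single i a) (Pi.single i b)
    rw [← Pi.single_mul] at h
    have := congrFun h i
    simpa using this⟩

/-- The extension `ι_i ∘ X ∘ π^i` by zero of a derivation of `A_i` to `⨁_i A_i`. -/
def derIncl (i : Fin r) (X : Der (A i)) : Der (∀ i, A i) :=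
  ⟨LinearMap.single ℂ A i ∘ₗ X.1 ∘ₗ LinearMap.proj i, by
    intro a b
    have h := X.2 (a i) (b i)
    funext j
    by_cases hj : j = i
    · subst hj
      simpa using h
    · simp [hj]⟩

theorem single_mem_center (i : Fin r) (f : Subalgebra.center ℂ (A i)) :
    Pi.single i (f : A i) ∈ Subalgebra.center ℂ (∀ i, A i) := by
  have hf := Subalgebra.mem_center_iff.1 f.2
  rw [Subalgebra.mem_center_iff]
  intro b
  funext j
  by_cases hj : j = i
  · subst hj
    simpa using hf (b j)
  · simp [hj]

theorem apply_mem_center (i : Fin r) (f : Subalgebra.center ℂ (∀ i, A i)) :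
    (f : ∀ i, A i) i ∈ Subalgebra.center ℂ (A i) := by
  have hf := Subalgebra.mem_center_iff.1 f.2
  rw [Subalgebra.mem_center_iff]
  intro b
  have := congrFun (hf (Pi.single i b)) i
  simpa using this

theorem derIncl_add (i : Fin r) (X Y : Der (A i)) :
    derIncl i (X + Y) = derIncl i X + derIncl i Y := by
  apply Subtype.ext
  refine LinearMap.ext fun a => ?_
  funext j
  by_cases hj : j = i
  · subst hj
    simp [derIncl]
  · simp [derIncl, hj]

theorem derIncl_smul (i : Fin r) (f : Subalgebra.center ℂ (A i)) (X : Der (A i)) :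
    derIncl i (f • X)
      = (⟨Pi.single i (f : A i), single_mem_center i f⟩ : Subalgebra.center ℂ (∀ i, A i)) •
        derIncl i X := by
  apply Subtype.ext
  refine LinearMap.ext fun a => ?_
  funext j
  by_cases hj : j = i
  · subst hj
    simp [derIncl, Subalgebra.smul_def]
  · simp [derIncl, Subalgebra.smul_def, hj]

theorem derProj_add (i : Fin r) (X Y : Der (∀ i, A i)) :
    derProj i (X + Y) = derProj i X + derProj i Y := by
  apply Subtype.ext
  refine LinearMap.ext fun a => ?_
  simp [derProj]

theorem derProj_smul (i : Fin r) (f : Subalgebra.center ℂ (∀ i, A i)) (X : Der (∀ i, A i)) :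
    derProj i (f • X)
      = (⟨(f : ∀ i, A i) i, apply_mem_center i f⟩ : Subalgebra.center ℂ (A i)) • derProj i X := by
  apply Subtype.ext
  refine LinearMap.ext fun a => ?_
  simp [derProj, Subalgebra.smul_def]

/-- The component `ω_i ∈ Ω^p_Der(A_i)` of a form `ω` on `⨁_i A_i`:
`ω_i(X_1, …, X_p) = π^i(ω(ι_i X_1, …, ι_i X_p))`. -/
def formProj (i : Fin r) {p : ℕ} (ω : Form (∀ i, A i) p) : Form (A i) p where
  toFun X := ω (fun k => derIncl i (X k)) i
  map_update_add' := by
    intro _ X k x y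
    have h (z : Der (A i)) : (fun l => derIncl i (Function.update X k z l))
        = Function.update (fun l => derIncl i (X l)) k (derIncl i z) := by
      funext l
      by_cases hl : l = k
      · subst hl; simp
      · simp [hl]
    rw [h, h, h, derIncl_add, ω.map_update_add, Pi.add_apply]
  map_update_smul' := by
    intro _ X k f x
    have h (z : Der (A i)) : (fun l => derIncl i (Function.update X k z l))
        = Function.update (fun l => derIncl i (X l)) k (derIncl i z) := by
      funext l
      by_cases hl : l = k
      · subst hl; simp
      · simp [hl]
    rw [h, h, derIncl_smul, ω.map_update_smul]
    simp [Subalgebra.smul_def]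
  map_eq_zero_of_eq' := by
    intro X k l hkl hne
    rw [ω.map_eq_zero_of_eq _ (by rw [hkl]) hne, Pi.zero_apply]

/-- The extension of a form `ω_i` on `A_i` by zero to `⨁_i A_i`:
`(X_1, …, X_p) ↦ ι_i(ω_i(X_{1,i}, …, X_{p,i}))`. -/
def formIncl (i : Fin r) {p : ℕ} (ω : Form (A i) p) : Form (∀ i, A i) p where
  toFun X := Pi.single i (ω (fun k => derProj i (X k)))
  map_update_add' := by
    intro _ X k x y
    have h (z : Der (∀ i, A i)) : (fun l => derProj i (Function.update X k z l))
        = Function.update (fun l => derProj i (X l)) k (derProj i z) := by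
      funext l
      by_cases hl : l = k
      · subst hl; simp
      · simp [hl]
    rw [h, h, h, derProj_add, ω.map_update_add, Pi.single_add]
  map_update_smul' := by
    intro _ X k f x
    have h (z : Der (∀ i, A i)) : (fun l => derProj i (Function.update X k z l))
        = Function.update (fun l => derProj i (X l)) k (derProj i z) := by
      funext l
      by_cases hl : l = k
      · subst hl; simp
      · simp [hl]
    rw [h, h, derProj_smul, ω.map_update_smul]
    funext j
    by_cases hj : j = i
    · subst hj
      simp [Subalgebra.smul_def]
    · simp [Subalgebra.smul_def, hj]
  map_eq_zero_of_eq' := by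
    intro X k l hkl hne
    rw [ω.map_eq_zero_of_eq _ (by rw [hkl]) hne, Pi.single_zero]

/-- `ω ↦ ω_i` on `Ω^*_Der`. -/
def formsProj (i : Fin r) : Forms (∀ i, A i) →+ Forms (A i) :=
  DirectSum.map fun _ => AddMonoidHom.mk' (fun ω => formProj i ω) (fun _ _ => rfl)

/-- `ω_i ↦ 0 ⊕ ⋯ ⊕ ω_i ⊕ ⋯ ⊕ 0` on `Ω^*_Der`. -/
def formsIncl (i : Fin r) : Forms (A i) →+ Forms (∀ i, A i) :=
  DirectSum.map fun _ => AddMonoidHom.mk' (fun ω => formIncl i ω)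
    (fun _ _ => by ext X : 1; exact Pi.single_add ..)

end Sums

/-! ### The matrix algebra `M_n`: metric, integral, Hodge operator -/

section Matrices

/-- `M_n = M_n(ℂ)`. -/
abbrev Mat (n : ℕ) : Type := Matrix (Fin n) (Fin n) ℂ

/-- `𝔰𝔩_n`, the traceless matrices in `M_n`. -/
abbrev Sl (n : ℕ) : Type := LieAlgebra.SpecialLinear.sl (Fin n) ℂ

theorem mem_sl {n : ℕ} (a : Mat n) :
    a ∈ LieAlgebra.SpecialLinear.sl (Fin n) ℂ ↔ a.trace = 0 := by
  exact Iff.rfl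

/-- `a ↦ ad_a` as a complex-linear map `𝔰𝔩_n → Der(M_n)`. -/
def slToDer (n : ℕ) : Sl n →ₗ[ℂ] Der (Mat n) where
  toFun a := innerDer (a : Mat n)
  map_add' a b := by
    apply Subtype.ext
    ext x : 1
    simp [innerDer]
    noncomm_ring
  map_smul' c a := by
    apply Subtype.ext
    ext x : 1
    simp [innerDer, smul_sub]

theorem slToDer_injective (n : ℕ) : Function.Injective (slToDer n) := by
  rw [injective_iff_map_eq_zero]
  intro a ha
  have hc : (a : Mat n) ∈ Set.center (Mat n) := by
    rw [Semigroup.mem_center_iff]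
    intro b
    have h : (a : Mat n) * b - b * a = 0 := LinearMap.congr_fun (congrArg Subtype.val ha) b
    exact (sub_eq_zero.1 h).symm
  rw [Matrix.center_eq_range] at hc
  obtain ⟨c, hc⟩ := hc
  have ht : (a : Mat n).trace = 0 := (mem_sl _).1 a.2
  apply Subtype.ext
  rcases Nat.eq_zero_or_pos n with rfl | hn
  · exact Subsingleton.elim _ _
  · have h0 : (n : ℂ) ≠ 0 := Nat.cast_ne_zero.2 hn.ne'
    rw [← hc] at ht
    have : c = 0 := by simpa [Matrix.trace, h0] using ht
    rw [← hc, this]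
    simp

theorem slToDer_surjective (n : ℕ) : Function.Surjective (slToDer n) := by
  intro X
  rcases Nat.eq_zero_or_pos n with rfl | hn
  · exact ⟨0, Subtype.ext (LinearMap.ext fun _ => Subsingleton.elim _ _)⟩
  have h0 : (n : ℂ) ≠ 0 := Nat.cast_ne_zero.2 hn.ne'
  let o : Fin n := ⟨0, hn⟩
  let a : Mat n := ∑ i, X.1 (Matrix.single i o 1) * Matrix.single o i 1
  have ha (b : Mat n) : a * b - b * a = X.1 b := by
    have h1 (i : Fin n) : (Matrix.single o i 1 : Mat n) * b = ∑ j, b i j • Matrix.single o j 1 := by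
      ext u v
      simp [Matrix.sum_apply, Matrix.single_apply, Matrix.mul_apply, ite_and]
    have h2 (j : Fin n) : b * (Matrix.single j o 1 : Mat n) = ∑ i, b i j • Matrix.single i o 1 := by
      ext u v
      simp [Matrix.sum_apply, Matrix.single_apply, Matrix.mul_apply, ite_and]
    have h3 : ∑ j : Fin n, (Matrix.single j o 1 : Mat n) * Matrix.single o j 1 = 1 := by
      ext u v
      simp [Matrix.sum_apply, Matrix.single_apply, Matrix.one_apply, ite_and]
    have h4 : a * b = ∑ j, X.1 (b * Matrix.single j o 1) * Matrix.single o j 1 := by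
      simp only [a, Finset.sum_mul, mul_assoc, h1, h2, Finset.mul_sum, map_sum, map_smul,
        Matrix.mul_smul, Matrix.smul_mul]
      exact Finset.sum_comm
    have h5 (j : Fin n) : X.1 (b * Matrix.single j o 1)
        = X.1 b * Matrix.single j o 1 + b * X.1 (Matrix.single j o 1) := X.2 _ _
    simp only [h4, h5, add_mul, Finset.sum_add_distrib, mul_assoc, ← Finset.mul_sum, h3, mul_one]
    simp [a]
  refine ⟨⟨a - (a.trace / n) • 1, ?_⟩, ?_⟩
  · rw [mem_sl]
    simp [Matrix.trace_sub, Matrix.trace_smul, h0]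
  · apply Subtype.ext
    refine LinearMap.ext fun b => ?_
    rw [← ha b]
    change (a - (a.trace / n) • 1) * b - b * (a - (a.trace / n) • 1) = _
    simp [sub_mul, mul_sub]

/-- The isomorphism `𝔰𝔩_n ≃ Der(M_n)`, `a ↦ ad_a`. -/
def slEquivDer (n : ℕ) : Sl n ≃ₗ[ℂ] Der (Mat n) :=
  LinearEquiv.ofBijective (slToDer n) ⟨slToDer_injective n, slToDer_surjective n⟩

/-- The canonical metric `g(ad_a, ad_b) = tr(a b)` for `a, b ∈ 𝔰𝔩_n`. -/
def metric {n : ℕ} (X Y : Der (Mat n)) : ℂ :=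
  Matrix.trace (((slEquivDer n).symm X : Mat n) * ((slEquivDer n).symm Y : Mat n))

/-- A complex-multilinear alternating map on `Der(M_n)` is multilinear over the center `ℂ 1`. -/
def formOfComplex {n q : ℕ} (f : (Der (Mat n)) [⋀^Fin q]→ₗ[ℂ] Mat n) : Form (Mat n) q where
  toFun := f
  map_update_add' X k x y := f.map_update_add X k x y
  map_update_smul' := by
    intro _ X k z x
    have hz : (z : Mat n) ∈ Set.center (Mat n) := z.2
    rw [Matrix.center_eq_range] at hz
    obtain ⟨c, hc⟩ := hz
    have hs (Y : Der (Mat n)) : z • Y = c • Y := by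
      apply Subtype.ext
      refine LinearMap.ext fun b => ?_
      change (z : Mat n) * Y.1 b = c • Y.1 b
      rw [← hc, Matrix.smul_eq_diagonal_mul]
      rfl
    rw [hs]
    refine (f.map_update_smul X k c x).trans ?_
    change _ = (z : Mat n) * _
    rw [← hc, Matrix.smul_eq_diagonal_mul]
    rfl
  map_eq_zero_of_eq' := f.map_eq_zero_of_eq'

variable {n : ℕ} {I : Type*} [Fintype I] [LinearOrder I] (E : Module.Basis I ℂ (Sl n))

/-- The basis `∂_α = ad_{E_α}` of `Der(M_n)` attached to a basis `E_α` of `𝔰𝔩_n`. -/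
def derBasis : Module.Basis I ℂ (Der (Mat n)) := E.map (slEquivDer n)

/-- `g_{αβ} = g(∂_α, ∂_β)`. -/
def gram : Matrix I I ℂ := Matrix.of fun α β => metric (derBasis E α) (derBasis E β)

/-- `√|g|`, the principal square root of the determinant `|g|` of `(g_{αβ})`. -/
def sqrtDet : ℂ := (gram E).det ^ (1 / 2 : ℂ)

/-- The increasing enumeration `α⁰_1 < α⁰_2 < ⋯` of the index set of the basis. -/
def ordIdx (I : Type*) [Fintype I] [LinearOrder I] : Fin (Fintype.card I) → I :=
  fun k => Fintype.orderIsoFinOfCardEq I rfl k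

/-- The completely antisymmetric symbol with `ε_{α⁰_1 … α⁰_d} = 1`, `d` the number of indices. -/
def eps (β : Fin (Fintype.card I) → I) : ℂ :=
  Matrix.det (Matrix.of fun k l => if β k = ordIdx I l then (1 : ℂ) else 0)

/-- `a ⊗ θ^{β_1} ∧ ⋯ ∧ θ^{β_q}`, where `θ^α` is the basis dual to `∂_α`; its value on
`(X_1, …, X_q)` is `det(θ^{β_k}(X_l))_{k,l} a`. -/
def thetaForm {q : ℕ} (a : Mat n) (β : Fin q → I) : Form (Mat n) q :=
  formOfComplex <| (LinearMap.toSpanSingleton ℂ (Mat n) a).compAlternatingMap <|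
    (Matrix.detRowAlternating (n := Fin q) (R := ℂ)).compLinearMap
      (LinearMap.pi fun k => (derBasis E).coord (β k))

theorem thetaForm_apply {n : ℕ} {I : Type*} (E : Module.Basis I ℂ (Sl n)) {q : ℕ} (a : Mat n) (β : Fin q → I) (X : Fin q → Der (Mat n)) :
    thetaForm E a β X
      = Matrix.det (Matrix.of fun k l => (derBasis E).coord (β k) (X l)) • a := by
  rw [← Matrix.det_transpose]
  rfl

/-- The noncommutative integral. The top-degree part of `ω` is
`a √|g| θ^{α⁰_1} ∧ ⋯ ∧ θ^{α⁰_d}` with `a = ω(∂_{α⁰_1}, …, ∂_{α⁰_d}) / √|g|`, and `∫ ω = tr(a)`;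
components of lower degree do not contribute. -/
def integral (ω : Forms (Mat n)) : ℂ :=
  Matrix.trace ((sqrtDet E)⁻¹ • ω (Fintype.card I) (fun k => derBasis E (ordIdx I k)))

/-- The Hodge operator on `p`-forms, `d` being the number of indices:
`⋆ω = 1/((d-p)! p!) √|g| ω_{ℓ'_1…ℓ'_p} g^{ℓ_1ℓ'_1} ⋯ g^{ℓ_pℓ'_p} ε_{ℓ_1…ℓ_d}
θ^{ℓ_{p+1}} ∧ ⋯ ∧ θ^{ℓ_d}` (summed over repeated indices). -/
def hodge (p : ℕ) (hp : p ≤ Fintype.card I) (ω : Form (Mat n) p) :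
    Form (Mat n) (Fintype.card I - p) :=
  ∑ l : Fin p → I, ∑ l' : Fin p → I, ∑ κ : Fin (Fintype.card I - p) → I,
    thetaForm E
      (((1 : ℂ) / (((Fintype.card I - p).factorial : ℂ) * (p.factorial : ℂ)) * sqrtDet E
          * (∏ k, (gram E)⁻¹ (l k) (l' k))
          * eps (fun k => Fin.append l κ (Fin.cast (Nat.add_sub_cancel' hp).symm k)))
        • ω (fun k => derBasis E (l' k))) κ

/-- The Hodge operator on `Ω^*_Der(M_n)`; forms of degree above the number of indices vanish. -/
def hodgeForms (ω : Forms (Mat n)) : Forms (Mat n) :=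
  ∑ p : Fin (Fintype.card I + 1),
    DirectSum.of (Form (Mat n)) (Fintype.card I - p)
      (hodge E p (Nat.lt_succ_iff.1 p.2) (ω p))

end Matrices

/-! ### Sums of matrix algebras -/

section SumsOfMatrices

/-- `A = M_{n_1} ⊕ ⋯ ⊕ M_{n_r}`. -/
abbrev SumMat {r : ℕ} (n : Fin r → ℕ) : Type := ∀ i, Mat (n i)

variable {r : ℕ} {n : Fin r → ℕ} {I : Fin r → Type*} [∀ i, Fintype (I i)]
  [∀ i, LinearOrder (I i)] (E : ∀ i, Module.Basis (I i) ℂ (Sl (n i)))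

/-- `∫_A ω = ∑_i ∫_i ω_i`. -/
def integralSum (ω : Forms (SumMat n)) : ℂ := ∑ i, integral (E i) (formsProj i ω)

/-- `⋆_A ω = ⨁_i ⋆_i ω_i`. -/
def hodgeSum (ω : Forms (SumMat n)) : Forms (SumMat n) :=
  ∑ i, formsIncl i (hodgeForms (E i) (formsProj i ω))

end SumsOfMatrices

/-! ### The block-diagonal inclusion and compatible forms -/

section Inclusion

variable {r : ℕ} {n : Fin r → ℕ} {mult : Fin r → ℕ} {m : ℕ} (hm : ∑ i, mult i * n i ≤ m)

/-- The diagonal position in `M_m` of the `u`-th diagonal entry of the `l`-th copy of `M_{n_i}`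
(all counted from `0`): `∑_{i' < i} mult i' * n i' + l * n i + u`. -/
def blockPos (i : Fin r) (l : Fin (mult i)) (u : Fin (n i)) : Fin m :=
  Fin.castLE hm (finSigmaFinEquiv (n := fun i => mult i * n i) ⟨i, finProdFinEquiv (l, u)⟩)

theorem blockPos_val (i : Fin r) (l : Fin (mult i)) (u : Fin (n i)) :
    (blockPos hm i l u : ℕ)
      = ∑ j : Fin i, mult (Fin.castLE i.2.le j) * n (Fin.castLE i.2.le j) + (l * n i + u) := by
  simp [blockPos, finSigmaFinEquiv_apply, mul_comm, add_comm]

/-- `φ_i^l : M_{n_i} → M_m` puts `a` at the `l`-th block reserved for `M_{n_i}` on the diagonal and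
`0` everywhere else. -/
def blockIncl (i : Fin r) (l : Fin (mult i)) (a : Mat (n i)) : Mat m :=
  ∑ u, ∑ v, Matrix.single (blockPos hm i l u) (blockPos hm i l v) (a u v)

/-- The inclusion `φ = ∑_i ∑_l φ_i^l ∘ π^i`, that is
`φ(a_1 ⊕ ⋯ ⊕ a_r) = diag(a_1, …, a_1, a_2, …, a_2, …, a_r, …, a_r, 0)`, with `mult i` copies of
`a_i`. -/
def blockDiag (a : SumMat n) : Mat m := ∑ i, ∑ l, blockIncl hm i l (a i)

variable {I : Fin r → Type*} (E : ∀ i, Module.Basis (I i) ℂ (Sl (n i)))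

/-- The inherited derivation `∂_{B,(i,l,α)} = φ_i^l(∂_α^i) = ad_{φ_i^l(E_α^i)}` of `M_m`. -/
def inherited (β : Σ i : Fin r, Fin (mult i) × I i) : Der (Mat m) :=
  innerDer (blockIncl hm β.1 β.2.1 (E β.1 β.2.2 : Mat (n β.1)))

/-- A basis `F` of `𝔰𝔩_m` with index set `J` is adapted to `φ`: an injective map `e` identifies
`J^φ = {(i, l, α)}` with a part of `J`, one has `F_{(i,l,α)} = φ_i^l(E_α^i)`, and the derivations
with index in `J^c = J ∖ J^φ` are orthogonal to the inherited ones. -/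
structure IsAdapted {J : Type*} (F : Module.Basis J ℂ (Sl m))
    (e : (Σ i : Fin r, Fin (mult i) × I i) → J) : Prop where
  injective : Function.Injective e
  inherited : ∀ β, (F (e β) : Mat m) = blockIncl hm β.1 β.2.1 (E β.1 β.2.2 : Mat (n β.1))
  orthogonal : ∀ β, ∀ γ ∉ Set.range e,
    metric (innerDer (F (e β) : Mat m)) (innerDer (F γ : Mat m)) = 0

/-- `φ`-compatibility of a form `ω = ⨁_i ω_i` on `⨁_i M_{n_i}` with a form `η` on `M_m`, for forms
that need not be homogeneous: `φ_i^l(ω_i(∂_{α_1}^i, …, ∂_{α_p}^i)) = η(φ_i^l(∂_{α_1}^i), …)` in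
degrees `p ≥ 1`. In degree `0`, where no derivation selects a block, it is `η = φ(ω)`. -/
structure IsCompatible (ω : Forms (SumMat n)) (η : Forms (Mat m)) : Prop where
  degree_zero : η 0 (fun k => k.elim0) = blockDiag hm (ω 0 (fun k => k.elim0))
  degree_pos : ∀ p : ℕ, 1 ≤ p → ∀ (i : Fin r) (l : Fin (mult i)) (α : Fin p → I i),
    blockIncl hm i l (formsProj i ω p (fun k => innerDer (E i (α k) : Mat (n i))))
      = η p (fun k => inherited hm E ⟨i, l, α k⟩)

end Inclusion

end NCForms

end

open NCForms

open scoped DirectSum BigOperators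

/-! Everything reduces to a closed formula on a single matrix algebra: `∫ w ∧ ⋆w = ∑_p (1/p!) g^{l_1
l'_1} ⋯ g^{l_p l'_p} tr(w_{l_1…l_p} w_{l'_1…l'_p})` (`integral_wedge_hodge`). The symbol `ε`, the
order on the basis and `√|g|` all cancel: the sum over permutations in the wedge product undoes the
`ε` of the Hodge operator (`sum_sign_levi_smul`), and the factor `√|g|` is divided out by the
integral.

For an adapted basis of `𝔰𝔩_m` the Gram matrix is block diagonal: distinct blocks `(i, l)` are
orthogonal because products of matrices supported in different diagonal blocks are traceless, the
complement is orthogonal by assumption, and block `(i, l)` carries the Gram matrix of `E i`. Hence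
the inverse metric restricts to that of `E i` (`IsAdapted.gram_inv_same`). Since `η` lives on tuples
from a single block, both index tuples of the contraction run over single blocks; the trace forces
the two blocks to agree, and each `(i, l)` contributes exactly the contraction of `ω_i`
(`contraction_eq_sum_blocks`). Counting the copies `l` gives the factor `mult i`; the case `mult i =
1` is the proposition. -/

namespace NCForms

/-! ### Combinatorics of the antisymmetric symbol. -/

section Symbol

variable {I : Type*} [DecidableEq I]

/-- The antisymmetric symbol on `N`-tuples of elements of `I` normalised by an enumeration of `I`. -/
noncomputable def levi {N : ℕ} (o : Fin N ≃ I) (β : Fin N → I) : ℂ :=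
  Matrix.det (Matrix.of fun k l => if β k = o l then (1 : ℂ) else 0)

theorem levi_comp_perm {N : ℕ} (o : Fin N ≃ I) (β : Fin N → I) (σ : Equiv.Perm (Fin N)) :
    levi o (β ∘ σ) = (Equiv.Perm.sign σ : ℂ) * levi o β := by
  unfold levi
  rw [← Matrix.det_permute]
  rfl

theorem levi_self {N : ℕ} (o : Fin N ≃ I) : levi o o = 1 := by
  unfold levi
  rw [← Matrix.det_one (n := Fin N) (R := ℂ)]
  congr 1
  ext k l
  simp [Matrix.one_apply]

theorem levi_eq_zero {N : ℕ} (o : Fin N ≃ I) (β : Fin N → I) {i j : Fin N} (hij : i ≠ j)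
    (h : β i = β j) : levi o β = 0 := by
  unfold levi
  refine Matrix.det_zero_of_row_eq hij ?_
  funext l
  simp [h]

theorem levi_equiv_mul_self {N : ℕ} (o π : Fin N ≃ I) : levi o π * levi o π = 1 := by
  have h : levi o π = (Equiv.Perm.sign (π.trans o.symm) : ℂ) := by
    have := levi_comp_perm o o (π.trans o.symm)
    rw [levi_self, mul_one] at this
    rw [← this]
    congr 1
    funext k
    simp
  rw [h]
  rcases Int.units_eq_one_or (Equiv.Perm.sign (π.trans o.symm)) with h | h <;> simp [h]

variable {M : Type*} [AddCommGroup M] [Module ℂ M]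

/-- The determinant is a generalised Kronecker delta: in its Leibniz expansion the term of `τ`
survives only at `κ = ρ ∘ τ⁻¹`, where its sign cancels the one produced by the antisymmetry of `f`.
Each of the `q!` permutations thus contributes `f ρ`. -/
theorem sum_det_delta_smul [Fintype I] {q : ℕ} (f : (Fin q → I) → M)
    (hf : ∀ κ (τ : Equiv.Perm (Fin q)), f (κ ∘ τ) = (Equiv.Perm.sign τ : ℂ) • f κ)
    (ρ : Fin q → I) :
    ∑ κ : Fin q → I, Matrix.det (Matrix.of fun k j => if κ k = ρ j then (1 : ℂ) else 0) • f κ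
      = (q.factorial : ℂ) • f ρ := by
  have h1 (κ : Fin q → I) :
      Matrix.det (Matrix.of fun k j => if κ k = ρ j then (1 : ℂ) else 0) • f κ
        = ∑ τ : Equiv.Perm (Fin q), if κ = ρ ∘ τ.symm then f ρ else 0 := by
    rw [Matrix.det_apply', Finset.sum_smul]
    refine Finset.sum_congr rfl fun τ _ => ?_
    simp only [Matrix.of_apply]
    rw [Finset.prod_ite_zero]
    by_cases h : κ = ρ ∘ τ.symm
    · subst h
      rw [if_pos (by simp), hf, if_pos rfl, smul_smul]
      rcases Int.units_eq_one_or (Equiv.Perm.sign τ) with h | h <;> simp [h]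
    · rw [if_neg, if_neg h]
      · simp
      · intro h'
        exact h (funext fun k => by simpa using h' (τ.symm k) (Finset.mem_univ _))
  simp only [h1]
  rw [Finset.sum_comm]
  simp [Fintype.card_perm, ← Nat.cast_smul_eq_nsmul ℂ]

theorem exists_equiv_comp_castAdd [Fintype I] {p q : ℕ} (hI : Fintype.card I = p + q)
    (l : Fin p → I) (hl : Function.Injective l) :
    ∃ π : Fin (p + q) ≃ I, ∀ k, π (Fin.castAdd q k) = l k := by
  rcases Nat.eq_zero_or_pos p with rfl | hp
  · exact ⟨Fintype.equivOfCardEq (by simp [hI]), fun k => k.elim0⟩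
  -- Only the first `p` values matter; `l ⟨0, hp⟩` is an arbitrary filler, which is why `p = 0` is
  -- treated apart.
  let f : Fin (p + q) → I := fun k => if h : (k : ℕ) < p then l ⟨k, h⟩ else l ⟨0, hp⟩
  obtain ⟨g, hg⟩ := Finset.exists_equiv_extend_of_card_eq (α := Fin (p + q)) (β := I)
    (t := Finset.univ) (by simp [hI]) (s := Finset.univ.image (Fin.castAdd q)) (f := f)
    (Finset.subset_univ _) (by
      intro a ha b hb hab
      simp only [Finset.coe_image, Finset.coe_univ, Set.image_univ, Set.mem_range] at ha hb
      obtain ⟨a, rfl⟩ := ha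
      obtain ⟨b, rfl⟩ := hb
      simp only [f, Fin.val_castAdd, Fin.is_lt, dite_true, Fin.eta] at hab
      rw [hl hab])
  refine ⟨g.trans (Equiv.subtypeUnivEquiv (by simp)), fun k => ?_⟩
  have := hg (Fin.castAdd q k) (by simp)
  simpa [f] using this

/-- A permutation sending no position of the second block into the first preserves both blocks, by
finiteness, so it comes from `S_p × S_q`. -/
theorem sum_perm_block {M : Type*} [AddCommGroup M] {p q : ℕ} (F : Equiv.Perm (Fin (p + q)) → M)
    (hF : ∀ σ, (∃ (k : Fin q) (j : Fin p), σ (Fin.natAdd p k) = Fin.castAdd q j) → F σ = 0) :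
    ∑ σ, F σ = ∑ ab : Equiv.Perm (Fin p) × Equiv.Perm (Fin q),
      F (finSumFinEquiv.permCongr (Equiv.Perm.sumCongrHom _ _ ab)) := by
  symm
  refine Finset.sum_of_injOn
    (fun ab => finSumFinEquiv.permCongr (Equiv.Perm.sumCongrHom _ _ ab)) ?_ ?_ ?_ ?_
  · exact ((Equiv.injective _).comp Equiv.Perm.sumCongrHom_injective).injOn
  · intro _ _; simp
  · intro σ _ hσ
    apply hF
    by_contra hcon
    push Not at hcon
    apply hσ
    have hmem : finSumFinEquiv.symm.permCongr σ
        ∈ (Equiv.Perm.sumCongrHom (Fin p) (Fin q)).range := by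
      refine Equiv.Perm.mem_sumCongrHom_range_of_perm_mapsTo_inl
        ((Equiv.Perm.perm_mapsTo_inl_iff_mapsTo_inr _).2 ?_)
      rintro _ ⟨k, rfl⟩
      rcases h : finSumFinEquiv.symm (σ (Fin.natAdd p k)) with j | j
      · exact absurd (by rw [Equiv.symm_apply_eq] at h; simpa using h) (hcon k j)
      · exact ⟨j, by simp [Equiv.permCongr_apply, h]⟩
    obtain ⟨ab, hab⟩ := hmem
    refine ⟨ab, by simp, ?_⟩
    change finSumFinEquiv.permCongr (Equiv.Perm.sumCongrHom _ _ ab) = σ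
    rw [hab]
    ext k
    simp [Equiv.permCongr_apply]
  · intro _ _; rfl

/-- This is where `ε` disappears. Complete `l` to an enumeration `π` of `I` and translate the
summation variable by `o⁻¹ ∘ π`. A repeated index kills `ε` unless the permutation is of the form
`(a, b)` in `S_p × S_q`; there the signs of `a` and `b` each occur twice, as does `ε(π)`, so all `p!
q!` surviving terms equal `f l`. -/
theorem sum_sign_levi_smul [Fintype I] {p q : ℕ} (o : Fin (p + q) ≃ I) (f : (Fin p → I) → M)
    (hf : ∀ κ (τ : Equiv.Perm (Fin p)), f (κ ∘ τ) = (Equiv.Perm.sign τ : ℂ) • f κ)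
    (hf0 : ∀ κ, ¬ Function.Injective κ → f κ = 0) (l : Fin p → I) :
    ∑ σ : Equiv.Perm (Fin (p + q)), ((Equiv.Perm.sign σ : ℂ) *
        levi o (Fin.append l fun k => o (σ (Fin.natAdd p k)))) •
        f (fun k => o (σ (Fin.castAdd q k)))
      = ((p.factorial : ℂ) * (q.factorial : ℂ)) • f l := by
  by_cases hl : Function.Injective l
  swap
  · rw [hf0 l hl, smul_zero]
    refine Finset.sum_eq_zero fun σ _ => ?_
    simp only [Function.Injective, not_forall] at hl
    obtain ⟨i, j, hij, hne⟩ := hl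
    rw [levi_eq_zero o _ (i := Fin.castAdd q i) (j := Fin.castAdd q j) (by simpa using hne)
      (by simpa using hij)]
    simp
  obtain ⟨π, hπ⟩ := exists_equiv_comp_castAdd
    (by rw [← Fintype.card_congr o, Fintype.card_fin]) l hl
  rw [← Equiv.sum_comp (Equiv.mulLeft (π.trans o.symm))]
  have hsign : (Equiv.Perm.sign (π.trans o.symm) : ℂ) = levi o π := by
    have := levi_comp_perm o o (π.trans o.symm)
    rw [levi_self, mul_one] at this
    rw [← this]
    congr 1
    funext k
    simp
  simp only [Equiv.coe_mulLeft, Equiv.Perm.sign_mul, Equiv.Perm.mul_apply, Equiv.trans_apply,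
    Equiv.apply_symm_apply, Units.val_mul, Int.cast_mul, hsign]
  rw [sum_perm_block]
  · have key (ab : Equiv.Perm (Fin p) × Equiv.Perm (Fin q)) :
        (levi o π * ((Equiv.Perm.sign (finSumFinEquiv.permCongr
            (Equiv.Perm.sumCongrHom _ _ ab)) : ℤ) : ℂ) *
          levi o (Fin.append l fun k => π (finSumFinEquiv.permCongr
            (Equiv.Perm.sumCongrHom _ _ ab) (Fin.natAdd p k)))) •
          f (fun k => π (finSumFinEquiv.permCongr
            (Equiv.Perm.sumCongrHom _ _ ab) (Fin.castAdd q k))) = f l := by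
      obtain ⟨a, b⟩ := ab
      have h1 : (fun k => π (finSumFinEquiv.permCongr
            (Equiv.Perm.sumCongrHom _ _ (a, b)) (Fin.castAdd q k))) = l ∘ a := by
        funext k
        simp [Equiv.permCongr_apply, hπ]
      -- The first `p` entries are `l` whatever `a` is, so only `b` contributes to the sign of this
      -- symbol.
      have h2 : (Fin.append l fun k => π (finSumFinEquiv.permCongr
            (Equiv.Perm.sumCongrHom _ _ (a, b)) (Fin.natAdd p k)))
          = π ∘ (finSumFinEquiv.permCongr (Equiv.Perm.sumCongrHom _ _ (1, b))) := by
        funext k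
        refine Fin.addCases (fun k => ?_) (fun k => ?_) k
        · simp [Equiv.permCongr_apply, hπ]
        · simp [Equiv.permCongr_apply]
      rw [h1, h2, hf, levi_comp_perm, smul_smul]
      have h3 : levi o π * levi o π = 1 := levi_equiv_mul_self o π
      simp only [Equiv.Perm.sign_permCongr, Equiv.Perm.sumCongrHom_apply,
        Equiv.Perm.sign_sumCongr, Units.val_mul, Int.cast_mul]
      rcases Int.units_eq_one_or (Equiv.Perm.sign a) with ha | ha <;>
      rcases Int.units_eq_one_or (Equiv.Perm.sign b) with hb | hb <;> simp [ha, hb, h3]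
    rw [Finset.sum_congr rfl fun ab _ => key ab]
    simp [Fintype.card_perm, ← Nat.cast_smul_eq_nsmul ℂ]
  · rintro σ ⟨k, j, hkj⟩
    rw [levi_eq_zero o (Fin.append l fun k => π (σ (Fin.natAdd p k)))
      (i := Fin.castAdd q j) (j := Fin.natAdd p k)]
    · simp
    · simp [Fin.ext_iff]; omega
    · simp [hkj, hπ]

end Symbol


/-! ### Values of forms on basis tuples, and graded components of wedge products. -/

section Evaluation

variable {A : Type*} [Ring A] [Algebra ℂ A]

theorem form_comp_perm {p : ℕ} (ω : Form A p) {I : Type*} (D : I → Der A) (κ : Fin p → I)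
    (τ : Equiv.Perm (Fin p)) :
    ω (fun k => D ((κ ∘ τ) k)) = (Equiv.Perm.sign τ : ℂ) • ω (fun k => D (κ k)) := by
  refine (ω.map_perm (fun k => D (κ k)) τ).trans ?_
  rcases Int.units_eq_one_or (Equiv.Perm.sign τ) with h | h <;> simp [h]

theorem form_eq_zero_of_not_injective {p : ℕ} (ω : Form A p) {I : Type*} (D : I → Der A)
    (κ : Fin p → I) (hκ : ¬ Function.Injective κ) : ω (fun k => D (κ k)) = 0 := by
  simp only [Function.Injective, not_forall] at hκ
  obtain ⟨i, j, hij, hne⟩ := hκ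
  exact ω.map_eq_zero_of_eq _ (by rw [hij]) hne

theorem form_sum_apply {p : ℕ} {ι : Type*} (s : Finset ι) (f : ι → Form A p)
    (X : Fin p → Der A) : (∑ a ∈ s, f a) X = ∑ a ∈ s, f a X :=
  map_sum (AddMonoidHom.mk' (fun ω : Form A p => ω X) fun _ _ => rfl) f s

theorem zero_wedge {p q : ℕ} (ζ : Form A q) : wedge (0 : Form A p) ζ = 0 :=
  DFunLike.congr_fun (map_zero (wedgeHom p q)) ζ

/-- With a right factor homogeneous of degree `q`, only the degree `p` part of `w` reaches degree `p
+ q`. This is what removes the cross terms between different degrees in `w ∧ ⋆w`. -/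
theorem wedgeForms_of_right_apply (w : Forms A) {p q : ℕ} (ζ : Form A q) :
    wedgeForms w (DirectSum.of (Form A) q ζ) (p + q) = wedge (w p) ζ := by
  induction w using DirectSum.induction_on with
  | zero =>
    rw [map_zero]
    exact (zero_wedge ζ).symm
  | of p' x =>
    rw [wedgeForms_of]
    by_cases h : p' = p
    · subst h
      rw [DirectSum.of_eq_same, DirectSum.of_eq_same]
    · rw [DirectSum.of_eq_of_ne _ _ _ (by omega), DirectSum.of_eq_of_ne _ _ _ (Ne.symm h)]
      exact (zero_wedge ζ).symm
  | add x y hx hy =>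
    rw [map_add, AddMonoidHom.add_apply, DirectSum.add_apply, hx, hy, DirectSum.add_apply]
    exact (DFunLike.congr_fun (map_add (wedgeHom p q) (x p) (y p)) ζ).symm

theorem wedgeForms_of_right_apply_cast (w : Forms A) {d p q : ℕ} (h : p + q = d) (ζ : Form A q)
    (X : Fin d → Der A) :
    wedgeForms w (DirectSum.of (Form A) q ζ) d X
      = wedge (w p) ζ (fun k => X (Fin.cast h k)) := by
  subst h
  rw [wedgeForms_of_right_apply]
  rfl

end Evaluation

/-! ### The closed formula for `∫ w ∧ ⋆w` on one matrix algebra. -/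

section Hodge

variable {n : ℕ} {I : Type*} [Fintype I] [LinearOrder I] (E : Module.Basis I ℂ (Sl n))

/-- The enumeration `ordIdx` of the index set as an equivalence from `Fin N`. -/
def ordEquiv (I : Type*) [Fintype I] [LinearOrder I] {N : ℕ} (h : N = Fintype.card I) :
    Fin N ≃ I :=
  (finCongr h).trans (Fintype.orderIsoFinOfCardEq I rfl).toEquiv

theorem ordEquiv_apply {N : ℕ} (h : N = Fintype.card I) (k : Fin N) :
    ordEquiv I h k = ordIdx I (Fin.cast h k) := rfl

/-- Degrees appear as `p + (d - p)` rather than `d`; moving to `levi`, whose length is free, absorbs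
the casts. -/
theorem eps_cast {N : ℕ} (h : N = Fintype.card I) (β : Fin N → I) :
    eps (fun k => β (Fin.cast h.symm k)) = levi (ordEquiv I h) β := by
  subst h
  rfl

theorem derBasis_apply_eq_innerDer {I : Type*} (E : Module.Basis I ℂ (Sl n)) (α : I) :
    derBasis E α = innerDer (E α : Mat n) :=
  Module.Basis.map_apply E (slEquivDer n) α

theorem gram_apply {I : Type*} (E : Module.Basis I ℂ (Sl n)) (α β : I) :
    gram E α β = Matrix.trace ((E α : Mat n) * (E β : Mat n)) := by
  simp [gram, metric, derBasis]

/-- On basis derivations the product of dual forms becomes a generalised Kronecker delta, and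
summing it against `ε` yields `(d - p)!`, which cancels the factorial in the definition. -/
theorem hodge_apply {p : ℕ} (hp : p ≤ Fintype.card I) (η : Form (Mat n) p)
    (ρ : Fin (Fintype.card I - p) → I) :
    hodge E p hp η (fun k => derBasis E (ρ k))
      = (sqrtDet E / (p.factorial : ℂ)) •
        ∑ l : Fin p → I, levi (ordEquiv I (Nat.add_sub_cancel' hp)) (Fin.append l ρ) •
          ∑ l' : Fin p → I, (∏ k, (gram E)⁻¹ (l k) (l' k)) •
            η (fun k => derBasis E (l' k)) := by
  have h1 (l l' : Fin p → I) :
      ∑ κ : Fin (Fintype.card I - p) → I, thetaForm E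
        (((1 : ℂ) / (((Fintype.card I - p).factorial : ℂ) * (p.factorial : ℂ)) * sqrtDet E
          * (∏ k, (gram E)⁻¹ (l k) (l' k))
          * eps (fun k => Fin.append l κ (Fin.cast (Nat.add_sub_cancel' hp).symm k)))
        • η (fun k => derBasis E (l' k))) κ (fun k => derBasis E (ρ k))
      = (sqrtDet E / (p.factorial : ℂ)) •
        levi (ordEquiv I (Nat.add_sub_cancel' hp)) (Fin.append l ρ) •
          (∏ k, (gram E)⁻¹ (l k) (l' k)) • η (fun k => derBasis E (l' k)) := by
    have hs := sum_det_delta_smul (q := Fintype.card I - p)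
      (fun κ => levi (ordEquiv I (Nat.add_sub_cancel' hp)) (Fin.append l κ))
      (by
        intro κ τ
        rw [smul_eq_mul]
        have h2 : Fin.append l (κ ∘ τ)
            = Fin.append l κ ∘ finSumFinEquiv.permCongr (Equiv.Perm.sumCongr 1 τ) := by
          funext k
          refine Fin.addCases (fun k => ?_) (fun k => ?_) k <;> simp [Equiv.permCongr_apply]
        rw [h2, levi_comp_perm, Equiv.Perm.sign_permCongr, Equiv.Perm.sign_sumCongr]
        simp) ρ
    have h3 (κ : Fin (Fintype.card I - p) → I) :
        Matrix.det (Matrix.of fun k j => (derBasis E).coord (κ k) (derBasis E (ρ j)))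
          = Matrix.det (Matrix.of fun k j => if κ k = ρ j then (1 : ℂ) else 0) := by
      congr 1
      ext k j
      simp [Finsupp.single_apply, eq_comm]
    simp only [thetaForm_apply, h3, eps_cast (Nat.add_sub_cancel' hp), smul_smul]
    rw [← Finset.sum_smul]
    congr 1
    simp only [smul_eq_mul] at hs
    have hq : ((Fintype.card I - p).factorial : ℂ) ≠ 0 := Nat.cast_ne_zero.2 (Nat.factorial_ne_zero _)
    have hp' : (p.factorial : ℂ) ≠ 0 := Nat.cast_ne_zero.2 (Nat.factorial_ne_zero _)
    calc _ = ((1 : ℂ) / (((Fintype.card I - p).factorial : ℂ) * (p.factorial : ℂ)) * sqrtDet E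
          * (∏ k, (gram E)⁻¹ (l k) (l' k))) * ∑ κ : Fin (Fintype.card I - p) → I,
            Matrix.det (Matrix.of fun k j => if κ k = ρ j then (1 : ℂ) else 0) *
            levi (ordEquiv I (Nat.add_sub_cancel' hp)) (Fin.append l κ) := by
          rw [Finset.mul_sum]
          exact Finset.sum_congr rfl fun κ _ => by ring
      _ = _ := by
          rw [hs]
          field_simp
  simp only [hodge, form_sum_apply, h1, Finset.smul_sum]

/-- The full contraction `∑ g^{l_1 l'_1} ⋯ g^{l_p l'_p} ω_{l_1…l_p} ω_{l'_1…l'_p}` followed by the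
trace. -/
noncomputable def contraction {p : ℕ} (ω : Form (Mat n) p) : ℂ :=
  ∑ l : Fin p → I, ∑ l' : Fin p → I, (∏ k, (gram E)⁻¹ (l k) (l' k)) *
    Matrix.trace (ω (fun k => derBasis E (l k)) * ω (fun k => derBasis E (l' k)))

/-- The `p! (d - p)!` from `sum_sign_levi_smul` cancels the normalisation of the wedge product; the
remaining `1/p!` is that of the Hodge operator. -/
theorem trace_wedge_hodge {p : ℕ} (hp : p ≤ Fintype.card I) (ω : Form (Mat n) p) :
    Matrix.trace (wedge ω (hodge E p hp ω)
      (fun k => derBasis E (ordIdx I (Fin.cast (Nat.add_sub_cancel' hp) k))))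
      = sqrtDet E * ((1 / (p.factorial : ℂ)) * contraction E ω) := by
  have h1 (σ : Equiv.Perm (Fin (p + (Fintype.card I - p)))) :
      Equiv.Perm.sign σ • (ω (fun k => derBasis E (ordIdx I (Fin.cast (Nat.add_sub_cancel' hp)
            (σ (Fin.castAdd _ k))))) *
        hodge E p hp ω (fun k => derBasis E (ordIdx I (Fin.cast (Nat.add_sub_cancel' hp)
            (σ (Fin.natAdd p k))))))
      = (sqrtDet E / (p.factorial : ℂ)) • ∑ l : Fin p → I,
        (((Equiv.Perm.sign σ : ℂ) * levi (ordEquiv I (Nat.add_sub_cancel' hp))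
          (Fin.append l fun k => ordEquiv I (Nat.add_sub_cancel' hp) (σ (Fin.natAdd p k)))) •
          ω (fun k => derBasis E (ordEquiv I (Nat.add_sub_cancel' hp) (σ (Fin.castAdd _ k))))) *
          ∑ l' : Fin p → I, (∏ k, (gram E)⁻¹ (l k) (l' k)) •
            ω (fun k => derBasis E (l' k)) := by
    rw [hodge_apply E hp ω fun k => ordIdx I (Fin.cast (Nat.add_sub_cancel' hp)
            (σ (Fin.natAdd p k)))]
    simp only [← ordEquiv_apply (Nat.add_sub_cancel' hp)]
    rw [Matrix.mul_smul, smul_comm, Finset.mul_sum, Finset.smul_sum]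
    congr 1
    refine Finset.sum_congr rfl fun l _ => ?_
    rw [Matrix.mul_smul, Matrix.smul_mul, mul_smul]
    rcases Int.units_eq_one_or (Equiv.Perm.sign σ) with h | h <;> simp [h]
  have h2 (l : Fin p → I) := sum_sign_levi_smul (ordEquiv I (Nat.add_sub_cancel' hp))
    (fun κ : Fin p → I => ω (fun k => derBasis E (κ k))) (form_comp_perm ω (derBasis E))
    (form_eq_zero_of_not_injective ω (derBasis E)) l
  rw [wedge_apply]
  simp only [h1]
  rw [← Finset.smul_sum, Finset.sum_comm]
  simp only [← Finset.sum_mul, h2]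
  have hq : ((Fintype.card I - p).factorial : ℂ) ≠ 0 := Nat.cast_ne_zero.2 (Nat.factorial_ne_zero _)
  have hp' : (p.factorial : ℂ) ≠ 0 := Nat.cast_ne_zero.2 (Nat.factorial_ne_zero _)
  simp only [Matrix.smul_mul, Matrix.trace_smul, Matrix.trace_sum,
    Finset.mul_sum, Matrix.mul_smul, smul_eq_mul, contraction]
  field_simp

/-- The trace form is nondegenerate on `𝔰𝔩_n`: a kernel vector of the Gram matrix gives a traceless
`a` with `tr(b a) = 0` for all traceless `b`, and `b = a*` forces `a = 0`. -/
theorem sqrtDet_ne_zero : sqrtDet E ≠ 0 := by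
  have hdet : (gram E).det ≠ 0 := by
    intro h
    obtain ⟨v, hv0, hv⟩ := Matrix.exists_mulVec_eq_zero_iff.2 h
    apply hv0
    set a : Sl n := ∑ β, v β • E β with ha
    have h1 (b : Sl n) : Matrix.trace ((b : Mat n) * (a : Mat n)) = 0 := by
      have hb : (b : Mat n) = ∑ α, E.repr b α • (E α : Mat n) :=
        (congrArg Subtype.val (E.sum_repr b).symm).trans
          (by rw [AddSubmonoidClass.coe_finsetSum]; rfl)
      rw [hb]
      have h2 (α : I) : Matrix.trace ((E α : Mat n) * (a : Mat n)) = 0 := by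
        have := congrFun hv α
        simp only [Matrix.mulVec, dotProduct, gram_apply, Pi.zero_apply] at this
        rw [← this, ha]
        simp [Finset.mul_sum, Matrix.trace_sum, mul_comm]
      simp [Finset.sum_mul, Matrix.trace_sum, h2]
    have h3 : (a : Mat n) = 0 := by
      have h4 : ((a : Mat n).conjTranspose).trace = 0 := by
        rw [Matrix.trace_conjTranspose, (mem_sl _).1 a.2, star_zero]
      open scoped ComplexOrder in
      exact Matrix.trace_conjTranspose_mul_self_eq_zero_iff.1 (h1 ⟨_, (mem_sl _).2 h4⟩)
    have h5 : ∑ β, v β • E β = 0 := Subtype.ext h3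
    exact funext fun β => Fintype.linearIndependent_iff.1 E.linearIndependent v h5 β
  rw [sqrtDet, Complex.cpow_def_of_ne_zero hdet]
  exact Complex.exp_ne_zero _

theorem isUnit_gram : IsUnit (gram E).det := by
  rw [isUnit_iff_ne_zero]
  intro h
  apply sqrtDet_ne_zero E
  rw [sqrtDet, h]
  simp

/-- Above the top degree every index tuple repeats. The degree sums can therefore be padded to any
common bound. -/
theorem contraction_eq_zero {p : ℕ} (hp : Fintype.card I < p) (ω : Form (Mat n) p) :
    contraction E ω = 0 := by
  refine Finset.sum_eq_zero fun l _ => Finset.sum_eq_zero fun l' _ => ?_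
  rw [form_eq_zero_of_not_injective ω (derBasis E) l]
  · simp
  · intro h
    have := Fintype.card_le_of_injective l h
    simp only [Fintype.card_fin] at this
    omega

theorem integral_wedge_hodge (w : Forms (Mat n)) {N : ℕ} (hN : Fintype.card I < N) :
    integral E (wedgeForms w (hodgeForms E w))
      = ∑ p ∈ Finset.range N, (1 / (p.factorial : ℂ)) * contraction E (w p) := by
  have h1 (p : Fin (Fintype.card I + 1)) :
      Matrix.trace (wedgeForms w (DirectSum.of (Form (Mat n)) (Fintype.card I - p)
        (hodge E p (Nat.lt_succ_iff.1 p.2) (w p))) (Fintype.card I)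
          (fun k => derBasis E (ordIdx I k)))
        = sqrtDet E * ((1 / ((p : ℕ).factorial : ℂ)) * contraction E (w p)) := by
    have hp := Nat.lt_succ_iff.1 p.2
    rw [wedgeForms_of_right_apply_cast w (Nat.add_sub_cancel' hp), trace_wedge_hodge]
  have h2 : ∑ p ∈ Finset.range (Fintype.card I + 1),
      (1 / (p.factorial : ℂ)) * contraction E (w p)
        = ∑ p ∈ Finset.range N, (1 / (p.factorial : ℂ)) * contraction E (w p) := by
    refine Finset.sum_subset (Finset.range_mono hN) fun p _ hp => ?_
    rw [contraction_eq_zero E (by simpa using hp), mul_zero]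
  rw [← h2, Finset.sum_range, integral, hodgeForms, map_sum, DirectSum.sum_apply,
    form_sum_apply, Matrix.trace_smul, Matrix.trace_sum, Finset.sum_congr rfl fun p _ => h1 p,
    ← Finset.mul_sum, smul_eq_mul, ← mul_assoc, inv_mul_cancel₀ (sqrtDet_ne_zero E), one_mul]

end Hodge


/-! ### Componentwise behaviour of forms on a direct sum of algebras. -/

section Components

variable {r : ℕ} {A : Fin r → Type*} [∀ i, Ring (A i)] [∀ i, Algebra ℂ (A i)]

theorem formsProj_apply (i : Fin r) (ω : Forms (∀ i, A i)) (p : ℕ) :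
    formsProj i ω p = formProj i (ω p) := rfl

theorem formsProj_of (i : Fin r) {p : ℕ} (ω : Form (∀ i, A i) p) :
    formsProj i (DirectSum.of _ p ω) = DirectSum.of _ p (formProj i ω) :=
  DirectSum.map_of _ _ _

theorem formProj_wedge (i : Fin r) {p q : ℕ} (ω : Form (∀ i, A i) p) (η : Form (∀ i, A i) q) :
    formProj i (wedge ω η) = wedge (formProj i ω) (formProj i η) := by
  ext X
  rw [wedge_apply]
  change wedge ω η _ i = _
  rw [wedge_apply, Pi.smul_apply, Finset.sum_apply]
  rfl

theorem formsProj_wedgeForms (i : Fin r) (ω η : Forms (∀ i, A i)) :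
    formsProj i (wedgeForms ω η) = wedgeForms (formsProj i ω) (formsProj i η) := by
  induction ω using DirectSum.induction_on with
  | zero => simp
  | add x y hx hy => simp only [map_add, AddMonoidHom.add_apply, hx, hy]
  | of p x =>
    induction η using DirectSum.induction_on with
    | zero => simp
    | add x y hx hy => simp only [map_add, hx, hy]
    | of q y => rw [wedgeForms_of, formsProj_of, formsProj_of, formsProj_of, wedgeForms_of,
        formProj_wedge]

theorem derProj_derIncl (i : Fin r) (X : Der (A i)) : derProj i (derIncl i X) = X := by
  apply Subtype.ext
  ext a
  simp [derProj, derIncl]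

theorem formsProj_formsIncl_same (i : Fin r) (ω : Forms (A i)) :
    formsProj i (formsIncl i ω) = ω := by
  refine DFinsupp.ext fun p => ?_
  change formProj i (formIncl i (ω p)) = ω p
  ext X
  change (Pi.single i _ : ∀ i, A i) i = _
  rw [Pi.single_eq_same]
  simp only [derProj_derIncl]

theorem formsProj_formsIncl_of_ne {i j : Fin r} (h : i ≠ j) (ω : Forms (A j)) :
    formsProj i (formsIncl j ω) = 0 := by
  refine DFinsupp.ext fun p => ?_
  change formProj i (formIncl j (ω p)) = 0
  ext X
  change (Pi.single j _ : ∀ i, A i) i = _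
  rw [Pi.single_eq_of_ne h]
  rfl

end Components

/-- Projection to the `i`-th component respects wedge products and sees only the `i`-th summand of
`⋆_A ω`. -/
theorem integralSum_wedge_hodgeSum {r : ℕ} {n : Fin r → ℕ} {I : Fin r → Type*}
    [∀ i, Fintype (I i)] [∀ i, LinearOrder (I i)] (E : ∀ i, Module.Basis (I i) ℂ (Sl (n i)))
    (ω : Forms (SumMat n)) :
    integralSum E (wedgeForms ω (hodgeSum E ω))
      = ∑ i, integral (E i) (wedgeForms (formsProj i ω) (hodgeForms (E i) (formsProj i ω))) := by
  refine Finset.sum_congr rfl fun i _ => ?_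
  rw [formsProj_wedgeForms, hodgeSum, map_sum, Finset.sum_eq_single i, formsProj_formsIncl_same]
  · exact fun j _ hj => formsProj_formsIncl_of_ne hj.symm _
  · simp

/-! ### Traces of block matrices. -/

section Blocks

variable {r : ℕ} {n : Fin r → ℕ} {mult : Fin r → ℕ} {m : ℕ} (hm : ∑ i, mult i * n i ≤ m)

theorem blockPos_eq_iff {i j : Fin r} {l : Fin (mult i)} {l' : Fin (mult j)} {u : Fin (n i)}
    {v : Fin (n j)} : blockPos hm i l u = blockPos hm j l' v ↔
      (⟨i, l, u⟩ : Σ i, Fin (mult i) × Fin (n i)) = ⟨j, l', v⟩ := by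
  constructor
  · intro h
    have h1 := finSigmaFinEquiv.injective (Fin.castLE_injective hm h)
    simp only [Sigma.mk.injEq] at h1
    obtain ⟨rfl, h1⟩ := h1
    rw [heq_eq_eq, EmbeddingLike.apply_eq_iff_eq] at h1
    rw [h1]
  · intro h
    cases h
    rfl

theorem blockPos_eq_iff_same {i : Fin r} {l : Fin (mult i)} {u v : Fin (n i)} :
    blockPos hm i l u = blockPos hm i l v ↔ u = v := by
  rw [blockPos_eq_iff]
  simp

theorem blockPos_ne {i j : Fin r} {l : Fin (mult i)} {l' : Fin (mult j)}
    (h : (⟨i, l⟩ : Σ i, Fin (mult i)) ≠ ⟨j, l'⟩) (u : Fin (n i)) (v : Fin (n j)) :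
    blockPos hm i l u ≠ blockPos hm j l' v := by
  rw [Ne, blockPos_eq_iff]
  intro h'
  cases h'
  exact h rfl

theorem blockIncl_apply_same (i : Fin r) (l : Fin (mult i)) (a : Mat (n i)) (u v : Fin (n i)) :
    blockIncl hm i l a (blockPos hm i l u) (blockPos hm i l v) = a u v := by
  simp [blockIncl, Matrix.sum_apply, Matrix.single_apply, blockPos_eq_iff_same, ite_and]

theorem blockIncl_apply_of_ne {i j : Fin r} {l : Fin (mult i)} {l' : Fin (mult j)}
    (h : (⟨i, l⟩ : Σ i, Fin (mult i)) ≠ ⟨j, l'⟩) (a : Mat (n i)) (u : Fin (n j)) (v : Fin m) :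
    blockIncl hm i l a (blockPos hm j l' u) v = 0 := by
  simp [blockIncl, Matrix.sum_apply, blockPos_ne hm h]

/-- The trace against an embedded block reads only the same block of `M`; both the isometry of
`φ_i^l` and the orthogonality of distinct blocks follow. -/
theorem trace_blockIncl_mul (i : Fin r) (l : Fin (mult i)) (a : Mat (n i)) (M : Mat m) :
    Matrix.trace (blockIncl hm i l a * M)
      = ∑ u, ∑ v, a u v * M (blockPos hm i l v) (blockPos hm i l u) := by
  simp [blockIncl, Finset.sum_mul, Matrix.trace_sum, Matrix.trace_single_mul]

theorem trace_blockIncl_mul_same (i : Fin r) (l : Fin (mult i)) (a b : Mat (n i)) :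
    Matrix.trace (blockIncl hm i l a * blockIncl hm i l b) = Matrix.trace (a * b) := by
  rw [trace_blockIncl_mul]
  simp [blockIncl_apply_same, Matrix.trace, Matrix.mul_apply]

theorem trace_blockIncl_mul_of_ne {i j : Fin r} {l : Fin (mult i)} {l' : Fin (mult j)}
    (h : (⟨i, l⟩ : Σ i, Fin (mult i)) ≠ ⟨j, l'⟩) (a : Mat (n i)) (b : Mat (n j)) :
    Matrix.trace (blockIncl hm i l a * blockIncl hm j l' b) = 0 := by
  rw [trace_blockIncl_mul]
  simp [blockIncl_apply_of_ne hm h.symm]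

/-- Sums over pairs of blocks reduce to the diagonal when distinct blocks are orthogonal. -/
theorem sum_blocks_eq_single {M : Type*} [AddCommMonoid M] (i : Fin r) (l : Fin (mult i))
    (f : ∀ j, Fin (mult j) → M)
    (hf : ∀ j l', (⟨i, l⟩ : Σ i, Fin (mult i)) ≠ ⟨j, l'⟩ → f j l' = 0) :
    ∑ j, ∑ l', f j l' = f i l := by
  rw [Finset.sum_eq_single i, Finset.sum_eq_single l]
  · intro l' _ h
    exact hf i l' (by simpa using h.symm)
  · simp
  · intro j _ h
    refine Finset.sum_eq_zero fun l' _ => hf j l' ?_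
    intro h'
    exact h (congrArg Sigma.fst h').symm
  · simp

theorem trace_blockDiag_mul (a b : SumMat n) :
    Matrix.trace (blockDiag hm a * blockDiag hm b)
      = ∑ i, (mult i : ℂ) * Matrix.trace (a i * b i) := by
  simp only [blockDiag, Finset.sum_mul, Matrix.trace_sum, Finset.mul_sum]
  refine Finset.sum_congr rfl fun i _ => ?_
  have h (l : Fin (mult i)) :
      ∑ j, ∑ l', Matrix.trace (blockIncl hm j l' (a j) * blockIncl hm i l (b i))
        = Matrix.trace (a i * b i) := by
    rw [sum_blocks_eq_single i l _ fun j l' h => trace_blockIncl_mul_of_ne hm h.symm _ _,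
      trace_blockIncl_mul_same]
  simp [h]

/-! ### Metric of an adapted basis and reduction of the contraction to blocks. -/

variable {I : Fin r → Type*} (E : ∀ i, Module.Basis (I i) ℂ (Sl (n i)))
  {J : Type*} (F : Module.Basis J ℂ (Sl m))
  {e : (Σ i : Fin r, Fin (mult i) × I i) → J}

variable {hm E F}

theorem IsAdapted.derBasis_apply (he : IsAdapted hm E F e)
    (β : Σ i : Fin r, Fin (mult i) × I i) : derBasis F (e β) = NCForms.inherited hm E β := by
  rw [NCForms.inherited, ← he.inherited, derBasis_apply_eq_innerDer]

theorem IsAdapted.gram_same (he : IsAdapted hm E F e) (i : Fin r) (l : Fin (mult i))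
    (α β : I i) : gram F (e ⟨i, l, α⟩) (e ⟨i, l, β⟩) = gram (E i) α β := by
  rw [gram_apply, gram_apply, he.inherited, he.inherited, trace_blockIncl_mul_same]

theorem IsAdapted.gram_of_ne (he : IsAdapted hm E F e) {i j : Fin r} {l : Fin (mult i)}
    {l' : Fin (mult j)} (h : (⟨i, l⟩ : Σ i, Fin (mult i)) ≠ ⟨j, l'⟩) (α : I i) (β : I j) :
    gram F (e ⟨i, l, α⟩) (e ⟨j, l', β⟩) = 0 := by
  rw [gram_apply, he.inherited, he.inherited, trace_blockIncl_mul_of_ne hm h]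

theorem IsAdapted.gram_complement (he : IsAdapted hm E F e)
    (β : Σ i : Fin r, Fin (mult i) × I i) {γ : J} (hγ : γ ∉ Set.range e) :
    gram F (e β) γ = 0 := by
  rw [← he.orthogonal β γ hγ, gram, Matrix.of_apply, derBasis_apply_eq_innerDer,
    derBasis_apply_eq_innerDer]

variable [Fintype J] [LinearOrder J] [∀ i, Fintype (I i)] [∀ i, LinearOrder (I i)]

theorem IsAdapted.gram_inv_same (he : IsAdapted hm E F e) (i : Fin r) (l : Fin (mult i))
    (α β : I i) : (gram F)⁻¹ (e ⟨i, l, α⟩) (e ⟨i, l, β⟩) = (gram (E i))⁻¹ α β := by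
  -- Row `α` of the inverse Gram matrix of `E i`, placed in block `(i, l)` and extended by zero. It
  -- is checked to be the corresponding row of the inverse of `gram F`.
  let v : J → ℂ := fun γ => ∑ β', (gram (E i))⁻¹ α β' * if γ = e ⟨i, l, β'⟩ then 1 else 0
  have hv : Matrix.vecMul v (gram F) = Pi.single (e ⟨i, l, α⟩) 1 := by
    funext γ
    have h1 : Matrix.vecMul v (gram F) γ
        = ∑ β', (gram (E i))⁻¹ α β' * gram F (e ⟨i, l, β'⟩) γ := by
      simp only [Matrix.vecMul, dotProduct, v, Finset.sum_mul]
      rw [Finset.sum_comm]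
      simp
    rw [h1]
    by_cases hγ : γ ∈ Set.range e
    · obtain ⟨⟨j, l', β'⟩, rfl⟩ := hγ
      by_cases h : (⟨i, l⟩ : Σ i, Fin (mult i)) = ⟨j, l'⟩
      · cases h
        simp only [he.gram_same]
        rw [← Matrix.mul_apply, Matrix.nonsing_inv_mul _ (isUnit_gram (E i)), Matrix.one_apply,
          Pi.single_apply]
        simp [he.injective.eq_iff, eq_comm]
      · simp only [he.gram_of_ne h, mul_zero, Finset.sum_const_zero]
        rw [Pi.single_eq_of_ne]
        rw [he.injective.ne_iff]
        intro h'
        cases h'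
        exact h rfl
    · simp only [he.gram_complement _ hγ, mul_zero, Finset.sum_const_zero]
      rw [Pi.single_eq_of_ne]
      rintro rfl
      exact hγ ⟨_, rfl⟩
  have h2 := congrArg (fun w => Matrix.vecMul w (gram F)⁻¹ (e ⟨i, l, β⟩)) hv
  simp only [Matrix.vecMul_vecMul, Matrix.mul_nonsing_inv _ (isUnit_gram F), Matrix.vecMul_one,
    Matrix.single_one_vecMul, Matrix.row_apply] at h2
  rw [← h2]
  simp [v, he.injective.eq_iff]

-- The entry at position `0` names the block, so `1 ≤ p` is essential: the empty tuple would be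
-- counted once for every block.
omit [LinearOrder J] [∀ i, LinearOrder (I i)] in
theorem sum_functions_eq_sum_blocks {M : Type*} [AddCommMonoid M] (he : Function.Injective e)
    {p : ℕ} (hp : 1 ≤ p) (f : (Fin p → J) → M)
    (h1 : ∀ L, (∃ k, L k ∉ Set.range e) → f L = 0)
    (h2 : ∀ β : Fin p → Σ i : Fin r, Fin (mult i) × I i,
      (∃ k k', (⟨(β k).1, (β k).2.1⟩ : Σ i : Fin r, Fin (mult i)) ≠ ⟨(β k').1, (β k').2.1⟩) →
        f (fun k => e (β k)) = 0) :
    ∑ L, f L = ∑ i, ∑ l : Fin (mult i), ∑ α : Fin p → I i, f (fun k => e ⟨i, l, α k⟩) := by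
  have h3 : ∑ x : Σ i : Fin r, Fin (mult i) × (Fin p → I i),
      f (fun k => e ⟨x.1, x.2.1, x.2.2 k⟩) = ∑ L, f L := by
    refine Finset.sum_of_injOn (fun x k => e ⟨x.1, x.2.1, x.2.2 k⟩) ?_ (by simp) ?_
      (fun _ _ => rfl)
    · rintro ⟨i, l, α⟩ _ ⟨j, l', α'⟩ _ h
      have h4 (k : Fin p) := he (congrFun h k)
      have h5 := h4 ⟨0, hp⟩
      simp only [Sigma.mk.injEq] at h5
      obtain ⟨rfl, h5⟩ := h5
      simp only [heq_eq_eq, Prod.mk.injEq] at h5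
      obtain ⟨rfl, -⟩ := h5
      have h6 : α = α' := funext fun k => by simpa using h4 k
      rw [h6]
    · intro L _ hL
      by_cases hr : ∃ k, L k ∉ Set.range e
      · exact h1 L hr
      push Not at hr
      choose β hβ using hr
      obtain rfl : (fun k => e (β k)) = L := funext hβ
      apply h2
      by_contra hcon
      push Not at hcon
      apply hL
      have h7 (k : Fin p) : ∃ α, β k = ⟨(β ⟨0, hp⟩).1, (β ⟨0, hp⟩).2.1, α⟩ := by
        have h8 := hcon k ⟨0, hp⟩
        rcases hk : β k with ⟨i, l, α⟩
        rcases h0 : β ⟨0, hp⟩ with ⟨j, l', α'⟩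
        rw [hk, h0] at h8
        cases h8
        exact ⟨α, rfl⟩
      choose α hα using h7
      refine ⟨⟨(β ⟨0, hp⟩).1, (β ⟨0, hp⟩).2.1, α⟩, by simp, ?_⟩
      funext k
      exact congrArg e (hα k).symm
  rw [← h3, Fintype.sum_sigma]
  simp only [Fintype.sum_prod_type]

theorem contraction_zero_form {n : ℕ} {I : Type*} [Fintype I] [LinearOrder I]
    (E : Module.Basis I ℂ (Sl n)) (ω : Form (Mat n) 0) :
    contraction E ω = Matrix.trace (ω (fun k => k.elim0) * ω (fun k => k.elim0)) := by
  have h (l : Fin 0 → I) : (fun k => derBasis E (l k)) = fun k => k.elim0 :=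
    Subsingleton.elim _ _
  simp [contraction, h]

theorem contraction_eq_sum_blocks (he : IsAdapted hm E F e) (ω : Forms (SumMat n))
    (η : Forms (Mat m)) (hcompat : IsCompatible hm E ω η)
    (hvanish : ∀ (p : ℕ) (X : Fin p → Der (Mat m)),
      (∃ k, ∃ γ ∉ Set.range e, X k = innerDer (F γ : Mat m)) → η p X = 0)
    (hmixed : ∀ (p : ℕ) (β : Fin p → Σ i : Fin r, Fin (mult i) × I i),
      (∃ k k', (⟨(β k).1, (β k).2.1⟩ : Σ i : Fin r, Fin (mult i)) ≠ ⟨(β k').1, (β k').2.1⟩) →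
        η p (fun k => NCForms.inherited hm E (β k)) = 0) (p : ℕ) :
    contraction F (η p) = ∑ i, (mult i : ℂ) * contraction (E i) (formsProj i ω p) := by
  rcases Nat.eq_zero_or_pos p with rfl | hp
  -- In degree `0` no index selects a block; the multiplicities come instead from the trace of a
  -- product of block-diagonal matrices.
  · simp only [contraction_zero_form]
    rw [hcompat.degree_zero, trace_blockDiag_mul]
    refine Finset.sum_congr rfl fun i _ => ?_
    have h : formsProj i ω 0 (fun k => k.elim0) = ω 0 (fun k => k.elim0) i := by
      rw [formsProj_apply]
      exact congrArg (fun X => ω 0 X i) (Subsingleton.elim _ _)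
    rw [h]
  have hv (L : Fin p → J) (hL : ∃ k, L k ∉ Set.range e) :
      η p (fun k => derBasis F (L k)) = 0 := by
    obtain ⟨k, hk⟩ := hL
    exact hvanish p _ ⟨k, L k, hk, derBasis_apply_eq_innerDer F (L k)⟩
  have hx (β : Fin p → Σ i : Fin r, Fin (mult i) × I i)
      (hβ : ∃ k k', (⟨(β k).1, (β k).2.1⟩ : Σ i : Fin r, Fin (mult i))
        ≠ ⟨(β k').1, (β k').2.1⟩) : η p (fun k => derBasis F (e (β k))) = 0 := by
    simp only [he.derBasis_apply]
    exact hmixed p β hβ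
  have hη (i : Fin r) (l : Fin (mult i)) (α : Fin p → I i) :
      η p (fun k => derBasis F (e ⟨i, l, α k⟩))
        = blockIncl hm i l (formsProj i ω p (fun k => derBasis (E i) (α k))) := by
    simp only [he.derBasis_apply]
    rw [← hcompat.degree_pos p hp]
    simp only [derBasis_apply_eq_innerDer]
  rw [contraction, sum_functions_eq_sum_blocks he.injective hp]
  · refine Finset.sum_congr rfl fun i _ => ?_
    have h (l : Fin (mult i)) : ∑ α : Fin p → I i, ∑ L' : Fin p → J,
        (∏ k, (gram F)⁻¹ (e ⟨i, l, α k⟩) (L' k)) *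
          Matrix.trace (η p (fun k => derBasis F (e ⟨i, l, α k⟩)) *
            η p (fun k => derBasis F (L' k))) = contraction (E i) (formsProj i ω p) := by
      refine Finset.sum_congr rfl fun α _ => ?_
      -- The second index tuple also lies in one block; if that block differs from `(i, l)`, the
      -- trace of the product of values vanishes, so mixed entries of the inverse metric never need
      -- to be computed.
      rw [sum_functions_eq_sum_blocks he.injective hp, sum_blocks_eq_single i l]
      · simp only [he.gram_inv_same, hη, trace_blockIncl_mul_same]
      · intro j l' hne
        simp only [hη, trace_blockIncl_mul_of_ne hm hne, mul_zero, Finset.sum_const_zero]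
      · intro L' hL'
        rw [hv L' hL']
        simp
      · intro β hβ
        rw [hx β hβ]
        simp
    simp [h]
  · intro L hL
    simp [hv L hL]
  · intro β hβ
    simp [hx β hβ]

end Blocks

end NCForms

/-! ### The proposition and its corollary. -/

open NCForms

theorem mainTheorem9
    {r : ℕ} (n : Fin r → ℕ) (mult : Fin r → ℕ) (m : ℕ) (hm : ∑ i, mult i * n i ≤ m)
    {I : Fin r → Type*} [∀ i, Fintype (I i)] [∀ i, LinearOrder (I i)]
    (E : ∀ i, Module.Basis (I i) ℂ (Sl (n i)))
    {J : Type*} [Fintype J] [LinearOrder J] (F : Module.Basis J ℂ (Sl m))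
    (e : (Σ i : Fin r, Fin (mult i) × I i) → J) (he : IsAdapted hm E F e)
    (ω : Forms (SumMat n)) (η : Forms (Mat m))
    (hcompat : IsCompatible hm E ω η)
    (hvanish : ∀ (p : ℕ) (X : Fin p → Der (Mat m)),
      (∃ k, ∃ γ ∉ Set.range e, X k = innerDer (F γ : Mat m)) → η p X = 0)
    (hmixed : ∀ (p : ℕ) (β : Fin p → Σ i : Fin r, Fin (mult i) × I i),
      (∃ k k', (⟨(β k).1, (β k).2.1⟩ : Σ i : Fin r, Fin (mult i)) ≠ ⟨(β k').1, (β k').2.1⟩) →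
        η p (fun k => inherited hm E (β k)) = 0) :
    (integral F (wedgeForms η (hodgeForms F η))
      = ∑ i, (mult i : ℂ) *
          integral (E i) (wedgeForms (formsProj i ω) (hodgeForms (E i) (formsProj i ω)))) ∧
    ((∀ i, mult i = 1) →
      integral F (wedgeForms η (hodgeForms F η))
        = integralSum E (wedgeForms ω (hodgeSum E ω))) := by
  have key : integral F (wedgeForms η (hodgeForms F η))
      = ∑ i, (mult i : ℂ) *
          integral (E i) (wedgeForms (formsProj i ω) (hodgeForms (E i) (formsProj i ω))) := by
    -- A bound exceeding every dimension involved, so that all degree sums have the same range and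
    -- can be compared degree by degree.
    set N := Fintype.card J + ∑ i, Fintype.card (I i) + 1 with hN
    have hI (i : Fin r) : Fintype.card (I i) < N := by
      have := Finset.single_le_sum (f := fun i => Fintype.card (I i)) (fun _ _ => Nat.zero_le _)
        (Finset.mem_univ i)
      omega
    rw [integral_wedge_hodge F η (N := N) (by omega)]
    simp only [contraction_eq_sum_blocks he ω η hcompat hvanish hmixed,
      fun i => integral_wedge_hodge (E i) (formsProj i ω) (hI i), Finset.mul_sum]
    rw [Finset.sum_comm]
    exact Finset.sum_congr rfl fun i _ => Finset.sum_congr rfl fun p _ => by ring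
  refine ⟨key, fun h1 => ?_⟩
  rw [key, integralSum_wedge_hodgeSum]
  simp [h1]
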